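/- Let $n$ be a natural number and let $\mathbb{F}$ be a field with $\operatorname{char}(\mathbb{F})\neq 2$ and $|\mathbb{F}|\geq n^2+1$ (in particular, $\mathbb{F}$ may be infinite). Let $M_n$ be the set of all $n\times n$ matrices over $\mathbb{F}$ and $\Sigma_n\subseteq M_n$ the set of symmetric ones. Let $\phi,\psi:\Sigma_n\to\Sigma_n$ be maps (not assumed linear), at least one of which is surjective, such that $$\det(\phi(x)-\psi(y))=\det(x-y)\qquad\text{for all } x,y\in\Sigma_n.$$ Then $\phi=\psi$, and there exist $x_0\in\Sigma_n$, $u\in M_n$ and $\beta\in\mathbb{F}$ with $\det(\beta u^2)=1$ such that $$\phi(x)=\beta\,u(x+x_0)u^t\qquad\text{for all } x\in\Sigma_n,$$ where $u^t$ denotes the transpose of $u$. -/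

import Mathlib

/-- The space of symmetric `n × n` matrices over a field `F`,
as a linear subspace of the space of all `n × n` matrices. -/
def symMatrices (F : Type*) [Field F] (n : ℕ) : Submodule F (Matrix (Fin n) (Fin n) F) where
  carrier := {x | x.IsSymm}
  add_mem' := fun hx hy => Matrix.IsSymm.add hx hy
  zero_mem' := Matrix.isSymm_zero
  smul_mem' := fun c _ hx => Matrix.IsSymm.smul hx c

open Matrix

/-! If `φ` is surjective, the determinant identity forces `ψ` to preserve every linear relation
among the functions `x ↦ det (x - y)`. Such a relation, restricted to principal submatrices, yields
relations of degree 0, 1 and 2 in the entries of the matrices involved (`sum_coeff`, `sum_smul`,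
`sum_minor`, `sum_minor_three`).

The determinant is affine along lines of direction `v vᵗ`. The degree 1 relations then make `ψ`
affine along these lines, and the degree 2 relations make its increments there of rank at most one.
Since `ψ` is injective, the increment does not depend on the base point (`eq_zero_of_pencil`), so `ψ
= L + ψ 0` with `L` linear and sending each `v vᵗ` to rank at most one.

The cardinality bound gives `det (L 1) ≠ 0`, and `L` is then a scaled congruence `x ↦ β u x uᵗ`
(`exists_eq_smul_congrLinear`). Substituting this back turns the identity into a two-term relation
that determines `φ` and gives `βⁿ (det u)² = 1`. -/

/-- The relation `∑ j, k j * det (x + a j) = 0`, valid for all symmetric `x`. -/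
def DetRelation {F : Type*} [Field F] {J : Type*} [Fintype J] {n : ℕ} (k : J → F)
    (a : J → Matrix (Fin n) (Fin n) F) : Prop :=
  ∀ x : Matrix (Fin n) (Fin n) F, x.IsSymm → ∑ j, k j * det (x + a j) = 0

/-- All `2 × 2` minors vanish, that is, the rank is at most one. -/
def MinorsVanish {F : Type*} [Field F] {n : ℕ} (M : Matrix (Fin n) (Fin n) F) : Prop :=
  ∀ a b c d, M a b * M c d = M a d * M c b

/-! ### Relations between translated determinants -/

section relations

variable {F : Type*} [Field F] {J : Type*} [Fintype J]

theorem det_add_single_self {n : ℕ} (A : Matrix (Fin (n + 1)) (Fin (n + 1)) F)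
    (p : Fin (n + 1)) :
    det (A + single p p 1) = det A + det (A.submatrix p.succAbove p.succAbove) := by
  have h : A + single p p (1 : F) = A.updateRow p (A p + Pi.single p 1) := by
    ext i j
    by_cases hi : i = p
    · subst hi
      simp [single_apply, Pi.single_apply, eq_comm]
    · simp [hi, Ne.symm hi]
  rw [h, det_updateRow_add, updateRow_eq_self]
  congr 1
  rw [det_succ_row _ p, Finset.sum_eq_single p]
  · have : (-1 : F) ^ (p + p : ℕ) = 1 := Even.neg_one_pow ⟨_, rfl⟩
    rw [this]
    simp only [updateRow_self, Pi.single_eq_same, one_mul]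
    congr 1
    ext i j
    simp
  · intro j _ hj
    simp [hj]
  · simp

/-- Pad `x` with a zero row and column at `p`. Adding `e_p e_pᵗ` changes each determinant by the
complementary principal minor, so subtracting two instances of the relation leaves the smaller one.
-/
theorem DetRelation.submatrix_succAbove {n : ℕ} {k : J → F}
    {a : J → Matrix (Fin (n + 1)) (Fin (n + 1)) F} (h : DetRelation k a) (p : Fin (n + 1)) :
    DetRelation k fun j => (a j).submatrix p.succAbove p.succAbove := by
  intro x hx
  obtain ⟨y, hy, rfl⟩ : ∃ y : Matrix (Fin (n + 1)) (Fin (n + 1)) F, y.IsSymm ∧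
      y.submatrix p.succAbove p.succAbove = x := by
    refine ⟨Matrix.of fun i j => p.insertNth (α := fun _ => F) 0
      (fun i' => p.insertNth (α := fun _ => F) 0 (fun j' => x i' j') j) i, ?_, ?_⟩
    · ext i j
      refine Fin.succAboveCases p ?_ (fun i' => ?_) i <;>
        refine Fin.succAboveCases p ?_ (fun j' => ?_) j <;> simp [hx.apply]
    · ext i j
      simp
  have h1 := h (y + single p p 1) (hy.add (by simp [IsSymm]))
  have h0 := h y hy
  have e : ∀ j, det (y + single p p 1 + a j) = det (y + a j) +
      det (y.submatrix p.succAbove p.succAbove + (a j).submatrix p.succAbove p.succAbove) := by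
    intro j
    rw [add_right_comm, det_add_single_self]
    rfl
  simpa [e, mul_add, Finset.sum_add_distrib, h0] using h1

theorem DetRelation.submatrix {n m : ℕ} {k : J → F} {a : J → Matrix (Fin n) (Fin n) F}
    (h : DetRelation k a) (f : Fin m → Fin n) (hf : Function.Injective f) :
    DetRelation k fun j => (a j).submatrix f f := by
  induction n with
  | zero =>
    have hm : m = 0 := by
      simpa using Fintype.card_le_of_injective f hf
    subst hm
    convert h using 2
    exact Subsingleton.elim _ _
  | succ n ih =>
    by_cases hs : Function.Surjective f
    · have hm : m = n + 1 := by
        simpa using Fintype.card_of_bijective ⟨hf, hs⟩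
      subst hm
      intro x hx
      let e := Equiv.ofBijective f ⟨hf, hs⟩
      have := h (x.submatrix e.symm e.symm) (by
        ext i j; exact hx.apply _ _)
      rw [← this]
      refine Finset.sum_congr rfl fun j _ => ?_
      rw [← det_submatrix_equiv_self e (x.submatrix e.symm e.symm + a j)]
      congr 2
      ext i j
      simp only [e, submatrix_apply, Matrix.add_apply, Equiv.symm_apply_apply]
      rfl
    · obtain ⟨p, hp⟩ := not_forall.1 hs
      have hp' : ∀ i, f i ≠ p := fun i hi => hp ⟨i, hi⟩
      choose g hg using fun i => Fin.exists_succAbove_eq (hp' i)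
      have hgi : Function.Injective g := fun i j hij => hf (by rw [← hg i, ← hg j, hij])
      have := ih (h.submatrix_succAbove p) g hgi
      intro x hx
      rw [← this x hx]
      refine Finset.sum_congr rfl fun j _ => ?_
      congr 3
      ext i l
      simp [hg]

theorem DetRelation.sum_coeff {n : ℕ} {k : J → F} {a : J → Matrix (Fin n) (Fin n) F}
    (h : DetRelation k a) : ∑ j, k j = 0 := by
  -- The empty principal minor is 1.
  simpa using h.submatrix (m := 0) Fin.elim0 (fun i => i.elim0) 0 (by simp [IsSymm])

theorem DetRelation.sum_minor {n : ℕ} {k : J → F} {a : J → Matrix (Fin n) (Fin n) F}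
    (h : DetRelation k a) {p q : Fin n} (hpq : p ≠ q) :
    ∑ j, k j * (a j p p * a j q q - a j p q * a j q p) = 0 := by
  have := h.submatrix ![p, q] (by
    intro i j; fin_cases i <;> fin_cases j <;> simp [hpq, hpq.symm]) 0 (by simp [IsSymm])
  simpa only [det_fin_two, Matrix.add_apply, submatrix_apply, Matrix.zero_apply, zero_add,
    cons_val] using this

/-- Diagonal entries are 1 × 1 principal minors. Off the diagonal, shifting `a_pq` by ±1 in a 2 × 2
minor and subtracting leaves `-4 a_pq`. -/
theorem DetRelation.sum_smul (h2 : (2 : F) ≠ 0) {n : ℕ} {k : J → F}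
    {a : J → Matrix (Fin n) (Fin n) F} (ha : ∀ j, (a j).IsSymm)
    (h : DetRelation k a) : ∑ j, k j • a j = 0 := by
  ext p q
  simp only [Matrix.sum_apply, Matrix.smul_apply, smul_eq_mul, Matrix.zero_apply]
  by_cases hpq : p = q
  · subst hpq
    have := h.submatrix (m := 1) (fun _ => p) (fun _ _ _ => Subsingleton.elim _ _) 0
      (by simp [IsSymm])
    simpa using this
  · have hf : Function.Injective ![p, q] := by
      intro i j; fin_cases i <;> fin_cases j <;> simp [hpq, Ne.symm hpq]
    have h1 := h.submatrix ![p, q] hf !![0, 1; 1, 0] (by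
      ext i j; fin_cases i <;> fin_cases j <;> rfl)
    have h3 := h.submatrix ![p, q] hf !![0, -1; -1, 0] (by
      ext i j; fin_cases i <;> fin_cases j <;> rfl)
    have h4 : (-(2 * 2) : F) * ∑ j, k j * a j p q = 0 := by
      refine Eq.trans ?_ ((congrArg₂ (· - ·) h1 h3).trans (sub_zero 0))
      rw [← Finset.sum_sub_distrib, Finset.mul_sum]
      refine Finset.sum_congr rfl fun j _ => ?_
      simp only [det_fin_two, Matrix.add_apply, submatrix_apply, of_apply, cons_val', cons_val,
        (ha j).apply p q]
      ring
    simpa [h2] using h4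

/-- Same device: a 3 × 3 principal minor is quadratic in `a_qr`, and shifting that entry by ±1
isolates its odd part. -/
theorem DetRelation.sum_minor_three (h2 : (2 : F) ≠ 0) {n : ℕ} {k : J → F}
    {a : J → Matrix (Fin n) (Fin n) F} (ha : ∀ j, (a j).IsSymm)
    (h : DetRelation k a) {p q r : Fin n} (hpq : p ≠ q) (hpr : p ≠ r) (hqr : q ≠ r) :
    ∑ j, k j * (a j p p * a j q r - a j p q * a j p r) = 0 := by
  have hf : Function.Injective ![p, q, r] := by
    intro i j
    fin_cases i <;> fin_cases j <;> simp [hpq, hpr, hqr, hpq.symm, hpr.symm, hqr.symm]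
  have h1 := h.submatrix ![p, q, r] hf !![0, 0, 0; 0, 0, 1; 0, 1, 0] (by
    ext i j; fin_cases i <;> fin_cases j <;> rfl)
  have h3 := h.submatrix ![p, q, r] hf !![0, 0, 0; 0, 0, -1; 0, -1, 0] (by
    ext i j; fin_cases i <;> fin_cases j <;> rfl)
  have h4 : (-(2 * 2) : F) * ∑ j, k j * (a j p p * a j q r - a j p q * a j p r) = 0 := by
    refine Eq.trans ?_ ((congrArg₂ (· - ·) h1 h3).trans (sub_zero 0))
    rw [← Finset.sum_sub_distrib, Finset.mul_sum]
    refine Finset.sum_congr rfl fun j _ => ?_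
    simp only [det_fin_three, Matrix.add_apply, submatrix_apply, of_apply, cons_val', cons_val,
      (ha j).apply p q, (ha j).apply q r, (ha j).apply p r]
    ring
  simpa [h2] using h4

/-- By a Schur complement this is the determinant of the bordered matrix with last row `(-s v, 1)`,
which is affine in `s`. -/
theorem det_add_smul_vecMulVec {n : ℕ} (A : Matrix (Fin n) (Fin n) F) (u v : Fin n → F) (s : F) :
    det (A + s • vecMulVec u v) = (1 - s) * det A + s * det (A + vecMulVec u v) := by
  have key : ∀ t : F, det (A + t • vecMulVec u v) = det (updateRow
      (fromBlocks A (replicateCol Unit u) 0 1) (Sum.inr ())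
      ((Sum.elim 0 1 : Fin n ⊕ Unit → F) + t • (Sum.elim (-v) 0 : Fin n ⊕ Unit → F))) := by
    intro t
    have : updateRow (fromBlocks A (replicateCol Unit u) 0 1) (Sum.inr ())
      ((Sum.elim 0 1 : Fin n ⊕ Unit → F) + t • (Sum.elim (-v) 0 : Fin n ⊕ Unit → F)) =
        fromBlocks A (replicateCol Unit u) (replicateRow Unit (-(t • v))) 1 := by
      ext i j
      rcases i with i | i <;> rcases j with j | j <;> simp [updateRow_apply]
    rw [this, det_fromBlocks_one₂₂]
    congr 1
    ext i j
    simp [vecMulVec_apply, mul_apply]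
    ring
  have h1 := key 1
  have h0 := key 0
  have hs := key s
  rw [det_updateRow_add, det_updateRow_smul] at h1 h0 hs
  simp only [one_smul, zero_smul, add_zero, zero_mul, one_mul] at h1 h0
  rw [hs, h1, h0]
  ring

end relations

/-! ### Symmetric matrices of rank at most one -/

section minors

variable {F : Type*} [Field F] {n : ℕ}

theorem minorsVanish_of_forall {M : Matrix (Fin n) (Fin n) F}
    (h : ∀ p q r, M p p * M q r = M p q * M p r) : MinorsVanish M := by
  intro a b c d
  by_cases h0 : ∀ p, M p p = 0
  · have hz : ∀ p q, M p q = 0 := by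
      intro p q
      have := h p q q
      rw [h0, zero_mul] at this
      exact mul_self_eq_zero.1 this.symm
    simp [hz]
  · obtain ⟨p, hp⟩ := not_forall.1 h0
    have e : ∀ q r, M q r = M p q * M p r / M p p := fun q r => by
      rw [eq_div_iff hp, ← h, mul_comm]
    rw [e a b, e c d, e a d, e c b]
    ring

theorem MinorsVanish.eq_zero_of_diag {M : Matrix (Fin n) (Fin n) F} (h : MinorsVanish M)
    (hM : M.IsSymm) (h0 : ∀ p, M p p = 0) : M = 0 := by
  ext p q
  have := h p p q q
  rw [h0, zero_mul, hM.apply p q] at this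
  exact mul_self_eq_zero.1 this.symm

/-- A nonzero-everywhere affine pencil of symmetric matrices of rank one is constant. -/
theorem eq_zero_of_pencil (h2 : (2 : F) ≠ 0) {C D : Matrix (Fin n) (Fin n) F} (hC : C.IsSymm)
    (hD : D.IsSymm) (h : ∀ s : F, MinorsVanish (C + s • D)) (h0 : ∀ s : F, C + s • D ≠ 0) :
    D = 0 := by
  have hC1 : MinorsVanish C := by simpa using h 0
  have hadd : ∀ a b c d, C a b * C c d + D a b * C c d + C a b * D c d + D a b * D c d =
      C a d * C c b + D a d * C c b + C a d * D c b + D a d * D c b := by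
    intro a b c d
    have := h 1 a b c d
    simp only [one_smul, Matrix.add_apply] at this
    linear_combination this
  have hsub : ∀ a b c d, C a b * C c d - D a b * C c d - C a b * D c d + D a b * D c d =
      C a d * C c b - D a d * C c b - C a d * D c b + D a d * D c b := by
    intro a b c d
    have := h (-1) a b c d
    simp only [neg_smul, one_smul, Matrix.add_apply, Matrix.neg_apply] at this
    linear_combination this
  have hcross : ∀ a b c d, D a b * C c d + C a b * D c d = D a d * C c b + C a d * D c b := by
    intro a b c d
    apply mul_left_cancel₀ h2
    linear_combination hadd a b c d - hsub a b c d
  have hD1 : MinorsVanish D := by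
    intro a b c d
    linear_combination hadd a b c d - hcross a b c d - hC1 a b c d
  have hne : ¬ ∀ p, C p p = 0 := fun hz => h0 0 (by
    simpa using hC1.eq_zero_of_diag hC hz)
  obtain ⟨p, hp⟩ := not_forall.1 hne
  -- `C`, `D` and their mixed minors all vanish, so the two are proportional. If `D ≠ 0`, some
  -- member of the pencil is then zero.
  have hprop : D = (D p p / C p p) • C := by
    have hrow : ∀ q, D p q = D p p / C p p * C p q := by
      intro q
      have e1 := hC1 p p q q
      have e2 := hD1 p p q q
      have e3 := hcross p p q q
      rw [hC.apply p q] at e1 e3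
      rw [hD.apply p q] at e2 e3
      have : (C p p * D p q - D p p * C p q) ^ 2 = 0 := by
        linear_combination (-C p p ^ 2) * e2 - D p p ^ 2 * e1 + C p p * D p p * e3
      have := pow_eq_zero_iff (two_ne_zero) |>.1 this
      field_simp
      linear_combination this
    ext q r
    have e1 := hC1 p p q r
    have e3 := hcross p p q r
    rw [hC.apply p q] at e1 e3
    rw [hD.apply p q, hrow q, hrow r] at e3
    simp only [Matrix.smul_apply, smul_eq_mul]
    apply mul_left_cancel₀ hp
    have h5 : D p p / C p p * C p p = D p p := div_mul_cancel₀ _ hp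
    linear_combination e3 - 2 * (D p p / C p p) * e1 + (C q r) * h5
  by_contra hDne
  have hδ : D p p / C p p ≠ 0 := fun hz => hDne (by rw [hprop, hz, zero_smul])
  apply h0 (-(D p p / C p p)⁻¹)
  nth_rewrite 2 [hprop]
  rw [smul_smul, neg_mul, inv_mul_cancel₀ hδ]
  simp

end minors

/-! ### Preserving determinant relations forces `ψ` to be affine -/

section affine

variable {F : Type*} [Field F] {n : ℕ}

/-- The symmetric matrix `v vᵗ`. -/
def rankOneSymm (v : Fin n → F) : symMatrices F n :=
  ⟨vecMulVec v v, by ext i j; simp [vecMulVec_apply, mul_comm]⟩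

theorem symMatrices.isSymm (x : symMatrices F n) : (x : Matrix (Fin n) (Fin n) F).IsSymm := x.2

/-- The symmetric matrix `e_i e_jᵗ + e_j e_iᵗ`. -/
def symmUnit (F : Type*) [Field F] {n : ℕ} (i j : Fin n) : symMatrices F n :=
  ⟨single i j 1 + single j i 1, by
    change (single i j (1 : F) + single j i 1)ᵀ = _
    simp [add_comm]⟩

theorem symmUnit_comm (i j : Fin n) : symmUnit F i j = symmUnit F j i :=
  Subtype.ext (add_comm _ _)

theorem rankOneSymm_add (v w : Fin n → F) : (rankOneSymm (v + w) : Matrix (Fin n) (Fin n) F) =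
    rankOneSymm v + rankOneSymm w + (vecMulVec v w + vecMulVec w v) := by
  simp only [rankOneSymm, add_vecMulVec, vecMulVec_add]
  abel

theorem rankOneSymm_single_add (i j : Fin n) (s : F) :
    rankOneSymm (Pi.single i 1 + Pi.single j s) = rankOneSymm (Pi.single i 1) +
      s • symmUnit F i j + s ^ 2 • rankOneSymm (Pi.single j 1) := by
  have hs : (Pi.single j s : Fin n → F) = s • Pi.single j 1 := by
    rw [← Pi.single_smul, smul_eq_mul, mul_one]
  apply Subtype.ext
  rw [rankOneSymm_add, hs]
  simp only [rankOneSymm, symmUnit, smul_vecMulVec, vecMulVec_smul,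
    ← single_eq_single_vecMulVec_single, Submodule.coe_add, Submodule.coe_smul]
  module

theorem rankOneSymm_single_add_add (i j k : Fin n) :
    rankOneSymm (Pi.single i (1 : F) + Pi.single j 1 + Pi.single k 1) =
      rankOneSymm (Pi.single i 1) + rankOneSymm (Pi.single j 1) + rankOneSymm (Pi.single k 1) +
        (symmUnit F i j + symmUnit F i k + symmUnit F j k) := by
  apply Subtype.ext
  rw [rankOneSymm_add, rankOneSymm_add]
  simp only [rankOneSymm, symmUnit, add_vecMulVec, vecMulVec_add,
    ← single_eq_single_vecMulVec_single, Submodule.coe_add]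
  abel

theorem symMatrices.eq_sum (h2 : (2 : F) ≠ 0) (y : symMatrices F n) :
    y = (2 : F)⁻¹ • ∑ i, ∑ j, (y : Matrix (Fin n) (Fin n) F) i j • symmUnit F i j := by
  apply Subtype.ext
  simp only [Submodule.coe_smul, Submodule.coe_sum, symmUnit]
  simp only [smul_add, smul_single, smul_eq_mul, mul_one, Finset.sum_add_distrib]
  rw [← matrix_eq_sum_single, Finset.sum_comm]
  have : ∑ j : Fin n, ∑ i : Fin n, single j i ((y : Matrix (Fin n) (Fin n) F) i j) = y := by
    nth_rewrite 2 [matrix_eq_sum_single (y : Matrix (Fin n) (Fin n) F)]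
    simp only [(symMatrices.isSymm y).apply]
  rw [this, ← smul_add, ← two_smul F (y : Matrix (Fin n) (Fin n) F), smul_smul,
    inv_mul_cancel₀ h2, one_smul]

theorem symMatrices.linearMap_ext {V : Type*} [AddCommGroup V] [Module F V] (h2 : (2 : F) ≠ 0)
    {f g : symMatrices F n →ₗ[F] V} (h : ∀ i j, f (symmUnit F i j) = g (symmUnit F i j)) :
    f = g := by
  ext y
  rw [symMatrices.eq_sum h2 y]
  simp only [map_smul, map_sum, h]

theorem span_rankOneSymm (h2 : (2 : F) ≠ 0) :
    Submodule.span F (Set.range (rankOneSymm : (Fin n → F) → symMatrices F n)) = ⊤ := by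
  refine eq_top_iff.2 fun y _ => ?_
  rw [symMatrices.eq_sum h2 y]
  have hm : ∀ v : Fin n → F, rankOneSymm v ∈ Submodule.span F (Set.range
      (rankOneSymm : (Fin n → F) → symMatrices F n)) :=
    fun v => Submodule.subset_span ⟨v, rfl⟩
  refine Submodule.smul_mem _ _ (Submodule.sum_mem _ fun i _ => Submodule.sum_mem _ fun j _ =>
    Submodule.smul_mem _ _ ?_)
  have : symmUnit F i j = rankOneSymm (Pi.single i 1 + Pi.single j 1) -
      rankOneSymm (Pi.single i 1) - rankOneSymm (Pi.single j 1) := by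
    rw [rankOneSymm_single_add]
    module
  rw [this]
  exact Submodule.sub_mem _ (Submodule.sub_mem _ (hm _) (hm _)) (hm _)

/-- `ψ` preserves the linear relations between the functions `x ↦ det (x - y)`. -/
def PreservesDetRelations (ψ : symMatrices F n → symMatrices F n) : Prop :=
  ∀ (m : ℕ) (k : Fin m → F) (a : Fin m → symMatrices F n),
    DetRelation k (fun j => -(a j : Matrix (Fin n) (Fin n) F)) →
      DetRelation k (fun j => -(ψ (a j) : Matrix (Fin n) (Fin n) F))

theorem preservesDetRelations_of_surjective {φ ψ : symMatrices F n → symMatrices F n}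
    (hφ : Function.Surjective φ)
    (hdet : ∀ x y : symMatrices F n,
      det ((φ x : Matrix (Fin n) (Fin n) F) - (ψ y : Matrix (Fin n) (Fin n) F)) =
        det ((x : Matrix (Fin n) (Fin n) F) - (y : Matrix (Fin n) (Fin n) F))) :
    PreservesDetRelations ψ := by
  intro m k a h w hw
  obtain ⟨x, hx⟩ := hφ ⟨w, hw⟩
  have hx' : w = φ x := by rw [hx]
  simpa only [hx', ← sub_eq_add_neg, hdet] using h x x.2

theorem DetRelation.add_const {J : Type*} [Fintype J] {k : J → F}
    {a : J → Matrix (Fin n) (Fin n) F} (h : DetRelation k a) {c : Matrix (Fin n) (Fin n) F}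
    (hc : c.IsSymm) : DetRelation k fun j => c + a j := by
  intro x hx
  simpa only [add_assoc] using h (x + c) (hx.add hc)

theorem injective_of_det_sub (h2 : (2 : F) ≠ 0) {φ ψ : symMatrices F n → symMatrices F n}
    (hdet : ∀ x y : symMatrices F n,
      det ((φ x : Matrix (Fin n) (Fin n) F) - (ψ y : Matrix (Fin n) (Fin n) F)) =
        det ((x : Matrix (Fin n) (Fin n) F) - (y : Matrix (Fin n) (Fin n) F))) :
    Function.Injective ψ := by
  intro y z hyz
  have h : DetRelation ![(1 : F), -1] (fun j => -(![y, z] j : Matrix (Fin n) (Fin n) F)) := by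
    intro x hx
    have e1 := hdet ⟨x, hx⟩ y
    have e2 := hdet ⟨x, hx⟩ z
    rw [hyz, e2] at e1
    simp only [Fin.sum_univ_two, cons_val, ← sub_eq_add_neg]
    rw [e1]
    ring
  have := h.sum_smul h2 fun j => (symMatrices.isSymm (![y, z] j)).neg
  simp only [Fin.sum_univ_two, cons_val] at this
  apply Subtype.ext
  rw [← sub_eq_zero, ← neg_eq_zero, ← this]
  module

namespace PreservesDetRelations

variable {ψ : symMatrices F n → symMatrices F n}

theorem detRelation_line (y : symMatrices F n) (v : Fin n → F) (s : F) :
    DetRelation ![1, -(1 - s), -s] (fun j =>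
      -((![y + s • rankOneSymm v, y, y + rankOneSymm v] j : symMatrices F n) :
        Matrix (Fin n) (Fin n) F)) := by
  intro x _
  have h := det_add_smul_vecMulVec (x + -(y : Matrix (Fin n) (Fin n) F)) (-v) v s
  simp only [neg_vecMulVec] at h
  have e1 : x + -((y + s • rankOneSymm v : symMatrices F n) : Matrix (Fin n) (Fin n) F) =
      x + -(y : Matrix (Fin n) (Fin n) F) + s • -vecMulVec v v := by
    simp [rankOneSymm]; abel
  have e2 : x + -((y + rankOneSymm v : symMatrices F n) : Matrix (Fin n) (Fin n) F) =
      x + -(y : Matrix (Fin n) (Fin n) F) + -vecMulVec v v := by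
    simp [rankOneSymm]; abel
  simp only [Fin.sum_univ_three, cons_val, e1, e2]
  rw [h]
  ring

theorem map_line (hψ : PreservesDetRelations ψ) (h2 : (2 : F) ≠ 0) (y : symMatrices F n)
    (v : Fin n → F) (s : F) :
    ψ (y + s • rankOneSymm v) = ψ y + s • (ψ (y + rankOneSymm v) - ψ y) := by
  have h := (hψ _ _ _ (detRelation_line y v s)).sum_smul h2 fun j =>
    (symMatrices.isSymm (ψ (![y + s • rankOneSymm v, y, y + rankOneSymm v] j))).neg
  simp only [Fin.sum_univ_three, cons_val] at h
  apply Subtype.ext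
  simp only [Submodule.coe_add, Submodule.coe_smul, Submodule.coe_sub]
  rw [← sub_eq_zero, ← neg_eq_zero, ← h]
  module

/-- At `s = -1` the line relation has coefficients 1, -2, 1 and, after translation, matrices `d`, 0,
`-d`. Its quadratic consequences are twice the minors of `d`. -/
theorem minorsVanish_sub (hψ : PreservesDetRelations ψ) (h2 : (2 : F) ≠ 0)
    (y : symMatrices F n) (v : Fin n → F) :
    MinorsVanish ((ψ (y + rankOneSymm v) - ψ y : symMatrices F n) :
      Matrix (Fin n) (Fin n) F) := by
  have h := (hψ _ _ _ (detRelation_line y v (-1))).add_const (symMatrices.isSymm (ψ y))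
  set d := ψ (y + rankOneSymm v) - ψ y with hd
  have hl := hψ.map_line h2 y v (-1)
  have hr : ψ (y + rankOneSymm v) = ψ y + d := by rw [hd]; abel
  have e : (fun j => (ψ y : Matrix (Fin n) (Fin n) F) +
      -(ψ (![y + (-1 : F) • rankOneSymm v, y, y + rankOneSymm v] j) : Matrix (Fin n) (Fin n) F)) =
      ![(d : Matrix (Fin n) (Fin n) F), 0, -d] := by
    funext j
    fin_cases j
    · simp only [Fin.zero_eta, cons_val, hl, ← hd]; simp
    · simp
    · simp only [Fin.reduceFinMk, cons_val, hr]; simp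
  rw [e] at h
  have hds := symMatrices.isSymm d
  have hs : ∀ j, (![(d : Matrix (Fin n) (Fin n) F), 0, -d] j).IsSymm := by
    intro j
    fin_cases j
    · exact hds
    · exact isSymm_zero
    · exact hds.neg
  apply minorsVanish_of_forall
  intro p q r
  by_cases hpq : p = q
  · subst hpq; rfl
  by_cases hpr : p = r
  · subst hpr; rw [hds.apply p q]; ring
  apply mul_left_cancel₀ h2
  by_cases hqr : q = r
  · subst hqr
    have := h.sum_minor hpq
    simp only [Fin.sum_univ_three, cons_val, Matrix.neg_apply, Matrix.zero_apply,
      hds.apply p q] at this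
    linear_combination this
  · have := h.sum_minor_three h2 hs hpq hpr hqr
    simp only [Fin.sum_univ_three, cons_val, Matrix.neg_apply, Matrix.zero_apply] at this
    linear_combination this

/-- The increment is an affine pencil `C + s D` of rank at most one; injectivity keeps it nonzero
when `v vᵗ ≠ 0`, so `D = 0`. -/
theorem sub_const_rankOneSymm (hψ : PreservesDetRelations ψ) (hinj : Function.Injective ψ)
    (h2 : (2 : F) ≠ 0) (y : symMatrices F n) (v z : Fin n → F) (s : F) :
    ψ (y + s • rankOneSymm z + rankOneSymm v) - ψ (y + s • rankOneSymm z) =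
      ψ (y + rankOneSymm v) - ψ y := by
  by_cases hv : rankOneSymm v = 0
  · simp [hv]
  set C := ψ (y + rankOneSymm v) - ψ y with hC
  set D := ψ (y + rankOneSymm z + rankOneSymm v) - ψ (y + rankOneSymm z) - C with hD
  have key : ∀ s : F, ψ (y + s • rankOneSymm z + rankOneSymm v) - ψ (y + s • rankOneSymm z) =
      C + s • D := by
    intro s
    rw [add_right_comm, hψ.map_line h2 (y + rankOneSymm v) z s, hψ.map_line h2 y z s, hD, hC,
      add_right_comm y (rankOneSymm v)]
    module
  have hD0 : (D : Matrix (Fin n) (Fin n) F) = 0 := by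
    apply eq_zero_of_pencil h2 (symMatrices.isSymm C) (symMatrices.isSymm D)
    · intro s
      have := hψ.minorsVanish_sub h2 (y + s • rankOneSymm z) v
      rw [key] at this
      exact this
    · intro s hs
      have : C + s • D = 0 := Subtype.ext hs
      rw [← key, sub_eq_zero] at this
      exact hv (by simpa using hinj this)
  rw [key, show D = 0 from Subtype.ext hD0, smul_zero, add_zero]

theorem exists_linear (hψ : PreservesDetRelations ψ)
    (hinj : Function.Injective ψ) (h2 : (2 : F) ≠ 0) :
    ∃ L : symMatrices F n →ₗ[F] symMatrices F n, (∀ y, ψ y = L y + ψ 0) ∧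
      ∀ v, MinorsVanish (L (rankOneSymm v) : Matrix (Fin n) (Fin n) F) := by
  have hspan : ∀ z : symMatrices F n, z ∈ Submodule.span F (Set.range
      (rankOneSymm : (Fin n → F) → symMatrices F n)) := fun z => by
    rw [span_rankOneSymm h2]; trivial
  have hconst : ∀ (z : symMatrices F n) (v : Fin n → F) (y : symMatrices F n),
      ψ (y + z + rankOneSymm v) - ψ (y + z) = ψ (y + rankOneSymm v) - ψ y := by
    intro z v
    induction hspan z using Submodule.closure_induction with
    | zero => simp
    | add z w _ _ hz hw =>
      intro y
      rw [← add_assoc, hw, hz]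
    | smul_mem c z hz =>
      obtain ⟨u, rfl⟩ := hz
      exact fun y => hψ.sub_const_rankOneSymm hinj h2 y v u c
  have main : ∀ z : symMatrices F n, ∃ r, ∀ y (s : F), ψ (y + s • z) = ψ y + s • r := by
    intro z
    induction hspan z using Submodule.span_induction with
    | mem z hz =>
      obtain ⟨v, rfl⟩ := hz
      refine ⟨ψ (0 + rankOneSymm v) - ψ 0, fun y s => ?_⟩
      rw [hψ.map_line h2, ← hconst y v 0, zero_add]
    | zero => exact ⟨0, fun y s => by simp⟩
    | add z w _ _ hz hw =>
      obtain ⟨r, hr⟩ := hz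
      obtain ⟨t, ht⟩ := hw
      refine ⟨r + t, fun y s => ?_⟩
      rw [smul_add, ← add_assoc, ht, hr, smul_add, add_assoc]
    | smul c z _ hz =>
      obtain ⟨r, hr⟩ := hz
      refine ⟨c • r, fun y s => ?_⟩
      rw [smul_smul, hr, smul_smul]
  have hval : ∀ (z y : symMatrices F n) (s : F), ψ (y + s • z) = ψ y + s • (ψ z - ψ 0) := by
    intro z y s
    obtain ⟨r, hr⟩ := main z
    have := hr 0 1
    rw [zero_add, one_smul, one_smul] at this
    rw [hr, this, add_sub_cancel_left]
  refine ⟨⟨⟨fun y => ψ y - ψ 0, fun y z => ?_⟩, fun s y => ?_⟩, fun y => ?_, fun v => ?_⟩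
  · have := hval z y 1
    rw [one_smul, one_smul] at this
    rw [this]
    abel
  · have := hval y 0 s
    rw [zero_add] at this
    simp [this]
  · simp
  · have := hψ.minorsVanish_sub h2 0 v
    rw [zero_add] at this
    exact this

end PreservesDetRelations

end affine

/-! ### Linear maps sending each `v vᵗ` to rank at most one -/

section structure_theorem

variable {F : Type*} [Field F] {n : ℕ}

theorem MinorsVanish.exists_eq_smul {M : Matrix (Fin n) (Fin n) F} (h : MinorsVanish M)
    (hM : M.IsSymm) : ∃ (α : F) (w : Fin n → F), M = α • vecMulVec w w := by
  by_cases h0 : ∀ p, M p p = 0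
  · exact ⟨0, 0, by rw [h.eq_zero_of_diag hM h0, zero_smul]⟩
  · obtain ⟨p, hp⟩ := not_forall.1 h0
    refine ⟨(M p p)⁻¹, M p, ?_⟩
    ext q r
    have := h p p q r
    rw [hM.apply p q] at this
    simp only [Matrix.smul_apply, vecMulVec_apply, smul_eq_mul]
    rw [eq_inv_mul_iff_mul_eq₀ hp]
    linear_combination this

/-- The linear map `x ↦ u x uᵗ`. -/
def congrLinear (u : Matrix (Fin n) (Fin n) F) :
    Matrix (Fin n) (Fin n) F →ₗ[F] Matrix (Fin n) (Fin n) F where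
  toFun x := u * x * uᵀ
  map_add' x y := by rw [Matrix.mul_add, Matrix.add_mul]
  map_smul' c x := by simp

theorem congrLinear_apply (u x : Matrix (Fin n) (Fin n) F) :
    congrLinear u x = u * x * uᵀ := rfl

theorem congrLinear_vecMulVec (u : Matrix (Fin n) (Fin n) F) (w : Fin n → F) :
    congrLinear u (vecMulVec w w) = vecMulVec (u *ᵥ w) (u *ᵥ w) := by
  rw [congrLinear_apply, mul_vecMulVec, vecMulVec_mul, vecMul_transpose]

theorem congrLinear_isSymm (u : Matrix (Fin n) (Fin n) F) {x : Matrix (Fin n) (Fin n) F}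
    (hx : x.IsSymm) : (congrLinear u x).IsSymm := by
  rw [congrLinear_apply, IsSymm, transpose_mul, transpose_mul, transpose_transpose, hx.eq,
    Matrix.mul_assoc]

theorem MinorsVanish.congrLinear {M : Matrix (Fin n) (Fin n) F} (h : MinorsVanish M)
    (hM : M.IsSymm) (u : Matrix (Fin n) (Fin n) F) : MinorsVanish (congrLinear u M) := by
  obtain ⟨α, w, rfl⟩ := h.exists_eq_smul hM
  rw [map_smul, congrLinear_vecMulVec]
  intro a b c d
  simp only [Matrix.smul_apply, vecMulVec_apply, smul_eq_mul]
  ring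

section diagonal

variable {N : symMatrices F n →ₗ[F] Matrix (Fin n) (Fin n) F} {α : Fin n → F}

/-- The image of `(e_i + s e_j)(e_i + s e_j)ᵗ` has vanishing minors for every `s`; comparing powers
of `s` determines the image of `symmUnit F i j`. -/
theorem map_symmUnit (h2 : (2 : F) ≠ 0) (hN : ∀ x, (N x).IsSymm)
    (hr : ∀ v, MinorsVanish (N (rankOneSymm v))) (hα : ∀ i, α i ≠ 0)
    (hE : ∀ i, N (rankOneSymm (Pi.single i 1)) = single i i (α i)) {i j : Fin n} (hij : i ≠ j)
    (hF : ∃ s : F, s ≠ 0 ∧ s ^ 2 ≠ 1) :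
    N (symmUnit F i j) = N (symmUnit F i j) i j • (single i j 1 + single j i 1) ∧
      N (symmUnit F i j) i j ^ 2 = α i * α j := by
  have hSs := hN (symmUnit F i j)
  generalize hS : N (symmUnit F i j) = S at hSs ⊢
  have hM : ∀ s : F, MinorsVanish (single i i (α i) + s • S + s ^ 2 • single j j (α j)) := by
    intro s
    have := hr (Pi.single i 1 + Pi.single j s)
    rw [rankOneSymm_single_add, map_add, map_add, map_smul, map_smul, hE, hE, hS] at this
    exact this
  have hm : ∀ s : F, (α i + s * S i i) * (s * S j j + s ^ 2 * α j) = s ^ 2 * S i j ^ 2 := by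
    intro s
    have := hM s i i j j
    simp only [Matrix.add_apply, Matrix.smul_apply, smul_eq_mul, single_apply, hij, hij.symm,
      hSs.apply i j] at this
    simp at this
    linear_combination this
  have hsum : α i * S j j + S i i * α j = 0 := by
    apply mul_left_cancel₀ h2
    linear_combination hm 1 - hm (-1)
  have hii : S i i = 0 := by
    -- The values ±1 cannot separate the `s` and `s ^ 3` terms; a third nonzero value does.
    obtain ⟨s, hs, hs1⟩ := hF
    have : s * (s ^ 2 - 1) * α j * S i i = 0 := by
      apply mul_left_cancel₀ h2
      linear_combination 2 * hm s - s ^ 2 * hm 1 - s ^ 2 * hm (-1) - 2 * s * hsum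
    have h1 : s * (s ^ 2 - 1) * α j ≠ 0 :=
      mul_ne_zero (mul_ne_zero hs (sub_ne_zero.2 hs1)) (hα j)
    exact (mul_eq_zero.1 this).resolve_left h1
  have hjj : S j j = 0 := by
    rw [hii, zero_mul, add_zero] at hsum
    exact (mul_eq_zero.1 hsum).resolve_left (hα i)
  have hkk : ∀ k, k ≠ i → k ≠ j → S k k = 0 := by
    intro k hki hkj
    have : ∀ s : F, α i * (s * S k k) = s ^ 2 * S i k ^ 2 := by
      intro s
      have := hM s i i k k
      simp only [Matrix.add_apply, Matrix.smul_apply, smul_eq_mul, single_apply, hij.symm,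
        hki.symm, hkj.symm, hSs.apply i k, hii] at this
      simp at this
      linear_combination this
    have h1 : 2 * α i * S k k = 0 := by
      linear_combination this 1 - this (-1)
    exact (mul_eq_zero.1 h1).resolve_left (mul_ne_zero h2 (hα i))
  have hdiag : ∀ k, S k k = 0 := by
    intro k
    by_cases hki : k = i
    · rw [hki, hii]
    by_cases hkj : k = j
    · rw [hkj, hjj]
    exact hkk k hki hkj
  have hoff : ∀ k l, k ≠ l → k ≠ i → k ≠ j → S k l = 0 := by
    intro k l hkl hki hkj
    have := hM 1 k k l l
    simp only [Matrix.add_apply, Matrix.smul_apply, smul_eq_mul, single_apply,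
      hki.symm, hkj.symm, hSs.apply k l, hdiag] at this
    simp at this
    exact this
  constructor
  · ext k l
    by_cases hkl : k = l
    · subst hkl
      have e1 : ¬ (i = k ∧ j = k) := fun h => hij (h.1.trans h.2.symm)
      have e2 : ¬ (j = k ∧ i = k) := fun h => hij (h.2.trans h.1.symm)
      simp [hdiag, e1, e2]
    by_cases hk : k ≠ i ∧ k ≠ j
    · simp [hoff k l hkl hk.1 hk.2, hk.1.symm, hk.2.symm]
    by_cases hl : l ≠ i ∧ l ≠ j
    · rw [← hSs.apply, hoff l k (Ne.symm hkl) hl.1 hl.2]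
      simp [hl.1.symm, hl.2.symm]
    have : (k = i ∧ l = j) ∨ (k = j ∧ l = i) := by grind
    rcases this with ⟨rfl, rfl⟩ | ⟨rfl, rfl⟩
    · simp [hij, hij.symm]
    · simp [hij, hij.symm, hSs.apply]
  · have := hm 1
    rw [hii, hjj] at this
    linear_combination -this

theorem exists_diagonal (h2 : (2 : F) ≠ 0) (hN : ∀ x, (N x).IsSymm)
    (hr : ∀ v, MinorsVanish (N (rankOneSymm v))) (hα : ∀ i, α i ≠ 0)
    (hE : ∀ i, N (rankOneSymm (Pi.single i 1)) = single i i (α i))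
    (hF : ∀ i j : Fin n, i ≠ j → ∃ s : F, s ≠ 0 ∧ s ^ 2 ≠ 1) [Nonempty (Fin n)] :
    ∃ (d : Fin n → F) (β : F), (∀ i, d i ≠ 0) ∧ β ≠ 0 ∧
      ∀ x, N x = β • congrLinear (diagonal d) x := by
  obtain ⟨o⟩ := ‹Nonempty (Fin n)›
  have hself : ∀ i, N (symmUnit F i i) = α i • (single i i 1 + single i i 1) := by
    intro i
    have : symmUnit F i i = (2 : F) • rankOneSymm (Pi.single i 1) := by
      apply Subtype.ext
      rw [two_smul]
      simp only [symmUnit, rankOneSymm, Submodule.coe_add, ← single_eq_single_vecMulVec_single]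
    rw [this, map_smul, hE, two_smul, smul_add, smul_single, smul_eq_mul, mul_one]
  -- The diagonal value is `α i` because `symmUnit F i i` is twice `e_i e_iᵗ`.
  let σ : Fin n → Fin n → F := fun i j => if i = j then α i else N (symmUnit F i j) i j
  have hσ : ∀ i j, N (symmUnit F i j) = σ i j • (single i j 1 + single j i 1) := by
    intro i j
    by_cases hij : i = j
    · subst hij
      simp only [σ, if_true]
      exact hself i
    · simp only [σ, if_neg hij]
      exact (map_symmUnit h2 hN hr hα hE hij (hF i j hij)).1
  have hσsq : ∀ i j, σ i j ^ 2 = α i * α j := by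
    intro i j
    by_cases hij : i = j
    · subst hij
      simp [σ, sq]
    · simp only [σ, if_neg hij]
      exact (map_symmUnit h2 hN hr hα hE hij (hF i j hij)).2
  have hσcomm : ∀ i j, σ i j = σ j i := by
    intro i j
    by_cases hij : i = j
    · rw [hij]
    · simp only [σ, if_neg hij, if_neg (Ne.symm hij)]
      rw [symmUnit_comm i j, (hN _).apply]
  have hσo : σ o o = α o := by simp [σ]
  have hmul : ∀ i j, α o * σ i j = σ o i * σ o j := by
    intro i j
    by_cases hij : i = j
    · subst hij
      rw [← sq, hσsq]
      simp [σ]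
    by_cases hio : i = o
    · rw [hio, hσo]
    by_cases hjo : j = o
    · rw [hjo, hσo, hσcomm i o, mul_comm]
    -- One minor on three distinct indices makes the signs of the square roots `σ` coherent, so `σ`
    -- factors through its row `o`.
    have := hr (Pi.single o 1 + Pi.single i 1 + Pi.single j 1) o o i j
    rw [rankOneSymm_single_add_add] at this
    simp only [map_add, hE, hσ, Matrix.add_apply, Matrix.smul_apply, smul_eq_mul, single_apply,
      hij, hio, hjo, Ne.symm hij, Ne.symm hio, Ne.symm hjo] at this
    simp at this
    linear_combination this
  refine ⟨σ o, (α o)⁻¹, fun i hi => ?_, inv_ne_zero (hα o), fun x => ?_⟩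
  · have := hσsq o i
    rw [hi] at this
    exact mul_ne_zero (hα o) (hα i) (by rw [← this]; ring)
  · have : N = (α o)⁻¹ • (congrLinear (diagonal (σ o))).comp (symMatrices F n).subtype := by
      apply symMatrices.linearMap_ext h2
      intro i j
      rw [hσ, LinearMap.smul_apply, LinearMap.comp_apply, congrLinear_apply, diagonal_transpose,
        eq_inv_smul_iff₀ (hα o), smul_smul, hmul]
      ext k l
      simp only [Submodule.subtype_apply, symmUnit, mul_diagonal, diagonal_mul,
        Matrix.smul_apply, Matrix.add_apply, single_apply, smul_eq_mul]
      by_cases h1 : i = k ∧ j = l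
      · obtain ⟨rfl, rfl⟩ := h1
        ring
      · by_cases h3 : j = k ∧ i = l
        · obtain ⟨rfl, rfl⟩ := h3
          ring
        · simp [h1, h3]
    rw [this]
    rfl

end diagonal

theorem exists_eq_smul_congrLinear (h2 : (2 : F) ≠ 0) (L : symMatrices F n →ₗ[F] symMatrices F n)
    (hr : ∀ v, MinorsVanish (L (rankOneSymm v) : Matrix (Fin n) (Fin n) F))
    (hF : ∀ i j : Fin n, i ≠ j → ∃ s : F, s ≠ 0 ∧ s ^ 2 ≠ 1)
    (hdet : det (L (∑ i, rankOneSymm (Pi.single i 1)) : Matrix (Fin n) (Fin n) F) ≠ 0) :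
    ∃ (u : Matrix (Fin n) (Fin n) F) (β : F), IsUnit u.det ∧ β ≠ 0 ∧
      ∀ x, (L x : Matrix (Fin n) (Fin n) F) = β • congrLinear u x := by
  cases isEmpty_or_nonempty (Fin n) with
  | inl h => exact ⟨1, 1, by simp, one_ne_zero, fun x => Subsingleton.elim _ _⟩
  | inr h =>
    choose α w hαw using fun i : Fin n =>
      (hr (Pi.single i 1)).exists_eq_smul (symMatrices.isSymm _)
    let W : Matrix (Fin n) (Fin n) F := of fun a i => w i a
    have hWcol : ∀ i, W *ᵥ Pi.single i 1 = w i := by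
      intro i
      ext a
      simp [W]
    -- The sum is the identity matrix; nonsingularity of its image makes `W` invertible and every `α
    -- i` nonzero, so congruence by `W⁻¹` reduces to the diagonal case.
    have hW : (L (∑ i, rankOneSymm (Pi.single i 1)) : Matrix (Fin n) (Fin n) F) =
        W * diagonal α * Wᵀ := by
      rw [map_sum, Submodule.coe_sum]
      simp only [hαw]
      ext a b
      rw [mul_apply]
      simp only [Matrix.sum_apply, Matrix.smul_apply, vecMulVec_apply, smul_eq_mul, mul_diagonal,
        transpose_apply, W, of_apply]
      exact Finset.sum_congr rfl fun i _ => by ring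
    rw [hW, det_mul, det_mul, det_transpose, det_diagonal] at hdet
    have hWu : IsUnit W.det := by
      rw [isUnit_iff_ne_zero]
      exact right_ne_zero_of_mul hdet
    have hα : ∀ i, α i ≠ 0 := fun i =>
      Finset.prod_ne_zero_iff.1 (right_ne_zero_of_mul (left_ne_zero_of_mul hdet)) i
        (Finset.mem_univ i)
    obtain ⟨d, β, hd, hβ, hN⟩ := exists_diagonal
      (N := (congrLinear W⁻¹).comp ((symMatrices F n).subtype.comp L)) (α := α) h2
      (fun x => congrLinear_isSymm _ (symMatrices.isSymm _))
      (fun v => (hr v).congrLinear (symMatrices.isSymm _) _) hα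
      (fun i => by
        rw [LinearMap.comp_apply, LinearMap.comp_apply, Submodule.subtype_apply, hαw, map_smul,
          congrLinear_vecMulVec, ← hWcol, mulVec_mulVec, nonsing_inv_mul _ hWu, one_mulVec,
          ← single_eq_single_vecMulVec_single, smul_single]
        simp) hF
    refine ⟨W * diagonal d, β, ?_, hβ, fun x => ?_⟩
    · rw [det_mul, det_diagonal]
      exact hWu.mul (isUnit_iff_ne_zero.2 (Finset.prod_ne_zero_iff.2 fun i _ => hd i))
    · have e : congrLinear W (congrLinear W⁻¹ (L x)) = L x := by
        simp only [congrLinear_apply]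
        rw [← Matrix.mul_assoc, ← Matrix.mul_assoc, mul_nonsing_inv _ hWu, Matrix.one_mul,
          Matrix.mul_assoc, ← transpose_mul, mul_nonsing_inv _ hWu, transpose_one,
          Matrix.mul_one]
      have := hN x
      simp only [LinearMap.comp_apply, Submodule.subtype_apply] at this
      rw [← e, this, map_smul]
      simp only [congrLinear_apply, transpose_mul, Matrix.mul_assoc]

end structure_theorem

/-! ### Nonsingularity of `L 1` and conclusion -/

section main_theorem

variable {F : Type*} [Field F] {n : ℕ}

theorem exists_det_sub_smul_one_ne_zero (hcard : ((n ^ 2 + 1 : ℕ) : Cardinal) ≤ Cardinal.mk F)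
    (M : Matrix (Fin n) (Fin n) F) : ∃ s : F, det (M - s • (1 : Matrix (Fin n) (Fin n) F)) ≠ 0 := by
  have hlt : (M.charpoly.natDegree : Cardinal) < Cardinal.mk F := by
    refine lt_of_lt_of_le (Nat.cast_lt.2 ?_) hcard
    rw [charpoly_natDegree_eq_dim, Fintype.card_fin]
    nlinarith
  obtain ⟨s, hs⟩ := M.charpoly.exists_eval_ne_zero_of_natDegree_lt_card
    M.charpoly_monic.ne_zero hlt
  refine ⟨s, fun h => hs ?_⟩
  rw [eval_charpoly, ← neg_sub, det_neg]
  rw [smul_one_eq_diagonal] at h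
  simp [h, scalar_apply]

theorem exists_ne_zero_sq_ne_one (hn : 1 < n)
    (hcard : ((n ^ 2 + 1 : ℕ) : Cardinal) ≤ Cardinal.mk F) :
    ∃ s : F, s ≠ 0 ∧ s ^ 2 ≠ 1 := by
  classical
  by_contra! h
  have hsub : (Set.univ : Set F) ⊆ (({0, 1, -1} : Finset F) : Set F) := by
    intro s _
    by_cases hs : s = 0
    · simp [hs]
    · rcases sq_eq_sq_iff_eq_or_eq_neg.1 ((h s hs).trans (one_pow 2).symm) with h1 | h1 <;> simp [h1]
  have h1 : Cardinal.mk F ≤ (3 : ℕ) := by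
    rw [← Cardinal.mk_univ]
    refine (Cardinal.mk_le_mk_of_subset hsub).trans ?_
    refine (Cardinal.mk_coe_finset (s := ({0, 1, -1} : Finset F))).le.trans ?_
    exact Nat.cast_le.2 Finset.card_le_three
  have := Nat.cast_le.1 (hcard.trans h1)
  -- For `n ≥ 2` the bound gives at least 5 elements, against at most 3.
  nlinarith

theorem eq_and_exists_congr (h2 : (2 : F) ≠ 0)
    (hcard : ((n ^ 2 + 1 : ℕ) : Cardinal) ≤ Cardinal.mk F)
    {φ ψ : symMatrices F n → symMatrices F n} (hφ : Function.Surjective φ)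
    (hdet : ∀ x y : symMatrices F n,
      det ((φ x : Matrix (Fin n) (Fin n) F) - (ψ y : Matrix (Fin n) (Fin n) F)) =
        det ((x : Matrix (Fin n) (Fin n) F) - (y : Matrix (Fin n) (Fin n) F))) :
    φ = ψ ∧ ∃ (x₀ : symMatrices F n) (u : Matrix (Fin n) (Fin n) F) (β : F),
      det (β • u ^ 2) = 1 ∧ ∀ x : symMatrices F n,
        (φ x : Matrix (Fin n) (Fin n) F) =
          β • (u * ((x : Matrix (Fin n) (Fin n) F) + (x₀ : Matrix (Fin n) (Fin n) F)) *
            u.transpose) := by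
  obtain ⟨L, hL, hr⟩ := (preservesDetRelations_of_surjective hφ hdet).exists_linear
    (injective_of_det_sub h2 hdet) h2
  have hF : ∀ i j : Fin n, i ≠ j → ∃ s : F, s ≠ 0 ∧ s ^ 2 ≠ 1 := fun i j hij =>
    exists_ne_zero_sq_ne_one (by have := Fin.val_ne_of_ne hij; omega) hcard
  have hone : ((∑ i, rankOneSymm (Pi.single i 1) : symMatrices F n) :
      Matrix (Fin n) (Fin n) F) = 1 := by
    rw [Submodule.coe_sum]
    simp only [rankOneSymm, ← single_eq_single_vecMulVec_single]
    rw [← diagonal_one, ← sum_single_eq_diagonal]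
  have hLdet : det (L (∑ i, rankOneSymm (Pi.single i 1)) : Matrix (Fin n) (Fin n) F) ≠ 0 := by
    intro h0
    -- For this `x`, `det (x - s • 1) = det (-s • L 1)`; were `L 1` singular, this would vanish for
    -- every `s`.
    obtain ⟨x, hx⟩ := hφ (ψ 0)
    obtain ⟨s, hs⟩ := exists_det_sub_smul_one_ne_zero hcard (x : Matrix (Fin n) (Fin n) F)
    apply hs
    have := hdet x (s • ∑ i, rankOneSymm (Pi.single i 1))
    rw [Submodule.coe_smul, hone] at this
    rw [← this, hx, hL (s • _), map_smul, Submodule.coe_add, sub_add_cancel_right, Submodule.coe_smul,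
      det_neg, det_smul, h0, mul_zero, mul_zero]
  obtain ⟨u, β, hu, hβ, hLu⟩ := exists_eq_smul_congrLinear h2 L hr hF hLdet
  have hinv : ∀ M : Matrix (Fin n) (Fin n) F,
      β • congrLinear u (β⁻¹ • congrLinear u⁻¹ M) = M := by
    intro M
    rw [map_smul, smul_smul, mul_inv_cancel₀ hβ, one_smul]
    simp only [congrLinear_apply]
    rw [← Matrix.mul_assoc, ← Matrix.mul_assoc, mul_nonsing_inv _ hu, Matrix.one_mul,
      Matrix.mul_assoc, ← transpose_mul, mul_nonsing_inv _ hu, transpose_one, Matrix.mul_one]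
  set K : F := β ^ n * u.det ^ 2 with hK
  have hdetK : ∀ M : Matrix (Fin n) (Fin n) F, det (β • congrLinear u M) = K * det M := by
    intro M
    rw [congrLinear_apply, det_smul, det_mul, det_mul, det_transpose, Fintype.card_fin]
    ring
  have key : ∀ x : symMatrices F n, K = 1 ∧
      (x : Matrix (Fin n) (Fin n) F) = β⁻¹ • congrLinear u⁻¹ ((φ x : Matrix (Fin n) (Fin n) F) - ψ 0) := by
    intro x
    set z := β⁻¹ • congrLinear u⁻¹ ((φ x : Matrix (Fin n) (Fin n) F) - ψ 0) with hz
    have hzs : z.IsSymm := (congrLinear_isSymm _ ((φ x - ψ 0).2)).smul _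
    -- Taking `y = -w` gives `K det (w + z) = det (w + x)` for all symmetric `w`; degrees 0 and 1 of
    -- this relation give `K = 1` and `z = x`.
    have hrel : DetRelation ![K, -1] ![z, (x : Matrix (Fin n) (Fin n) F)] := by
      intro w hw
      have h := hdet x ⟨-w, hw.neg⟩
      have e : (φ x : Matrix (Fin n) (Fin n) F) - ψ ⟨-w, hw.neg⟩ = β • congrLinear u (w + z) := by
        rw [hL, Submodule.coe_add, hLu, map_add, smul_add, hz, hinv, map_neg, smul_neg]
        abel
      rw [e, hdetK, sub_neg_eq_add, add_comm (x : Matrix (Fin n) (Fin n) F) w] at h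
      simp only [Fin.sum_univ_two, cons_val, h]
      ring
    have h1 := hrel.sum_coeff
    simp only [Fin.sum_univ_two, cons_val] at h1
    have hK1 : K = 1 := by linear_combination h1
    have h3 := hrel.sum_smul h2 (by
      intro j
      fin_cases j
      · exact hzs
      · exact x.2)
    simp only [Fin.sum_univ_two, cons_val, hK1, neg_smul, one_smul, ← sub_eq_add_neg] at h3
    exact ⟨hK1, (sub_eq_zero.1 h3).symm⟩
  have hφL : ∀ x : symMatrices F n,
      (φ x : Matrix (Fin n) (Fin n) F) = β • congrLinear u x + ψ 0 := by
    intro x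
    rw [(key x).2, hinv, sub_add_cancel]
  refine ⟨?_, ⟨β⁻¹ • congrLinear u⁻¹ (ψ 0 : Matrix (Fin n) (Fin n) F),
    (congrLinear_isSymm _ (ψ 0).2).smul _⟩, u, β, ?_, fun x => ?_⟩
  · funext x
    apply Subtype.ext
    rw [hφL, hL x, Submodule.coe_add, hLu]
  · rw [det_smul, det_pow, Fintype.card_fin]
    exact (key 0).1
  · rw [← congrLinear_apply, map_add, smul_add, hinv, hφL]

end main_theorem

theorem mainTheorem3 {F : Type*} [Field F] (n : ℕ)
    (hchar : ringChar F ≠ 2)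
    (hcard : ((n ^ 2 + 1 : ℕ) : Cardinal) ≤ Cardinal.mk F)
    (φ ψ : symMatrices F n → symMatrices F n)
    (hsurj : Function.Surjective φ ∨ Function.Surjective ψ)
    (hdet : ∀ x y : symMatrices F n,
      Matrix.det ((φ x : Matrix (Fin n) (Fin n) F) - (ψ y : Matrix (Fin n) (Fin n) F)) =
        Matrix.det ((x : Matrix (Fin n) (Fin n) F) - (y : Matrix (Fin n) (Fin n) F))) :
    φ = ψ ∧
      ∃ (x₀ : symMatrices F n) (u : Matrix (Fin n) (Fin n) F) (β : F),
        Matrix.det (β • u ^ 2) = 1 ∧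
        ∀ x : symMatrices F n,
          (φ x : Matrix (Fin n) (Fin n) F) =
            β • (u * ((x : Matrix (Fin n) (Fin n) F) + (x₀ : Matrix (Fin n) (Fin n) F)) *
              u.transpose) := by
  have h2 : (2 : F) ≠ 0 := Ring.two_ne_zero hchar
  rcases hsurj with hφ | hψ
  · exact eq_and_exists_congr h2 hcard hφ hdet
  · have hdet' : ∀ x y : symMatrices F n,
        Matrix.det ((ψ x : Matrix (Fin n) (Fin n) F) - (φ y : Matrix (Fin n) (Fin n) F)) =
          Matrix.det ((x : Matrix (Fin n) (Fin n) F) - (y : Matrix (Fin n) (Fin n) F)) := by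
      intro x y
      rw [← neg_sub, Matrix.det_neg, hdet, ← Matrix.det_neg, neg_sub]
    obtain ⟨h, h'⟩ := eq_and_exists_congr h2 hcard hψ hdet'
    subst h
    exact ⟨rfl, h'⟩
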